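/- There is a polynomial $P$ in four variables with real coefficients such that the following holds. Let $A\in\mathbb{R}^{n\times n}$ be a matrix with nonnegative entries and let $r,c\in\mathbb{N}^n$ (zero entries are allowed) with $\|r\|_1=\|c\|_1=h$. Suppose that $A$ is asymptotically $(r,c)$-scalable, that is, there is a sequence of pairs of vectors $x^{(k)},y^{(k)}\in\mathbb{R}^n_{>0}$ such that the row sums of $B^{(k)}:=\mathrm{diag}(x^{(k)})\,A\,\mathrm{diag}(y^{(k)})$ converge to $r$ and its column sums converge to $c$ as $k\to\infty$. Let $L_A:=\max\{|\log A_{i,j}| : A_{i,j}\neq 0\}$ (and $L_A:=0$ if $A=0$). Then for every $\varepsilon>0$ there are vectors $x,y\in\mathbb{R}^n_{>0}$ with $$\Big|\sum_{k=1}^n x_i y_k A_{i,k}-r_i\Big|<\varepsilon\quad\text{for all } i\in[n],\qquad \Big|\sum_{l=1}^n x_l y_j A_{l,j}-c_j\Big|<\varepsilon\quad\text{for all } j\in[n],$$ and $$|\log x_i|\le P\big(n,L_A,h,\log\tfrac1\varepsilon\big),\qquad |\log y_j|\le P\big(n,L_A,h,\log\tfrac1\varepsilon\big)\qquad\text{for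 all } i,j\in[n].$$ -/

import Mathlib

open Filter Topology
open scoped Matrix

/-- The scaled matrix `X A Y`, where `X = diag(x)` and `Y = diag(y)`. -/
def scaledMatrix {n : ℕ} (A : Matrix (Fin n) (Fin n) ℝ) (x y : Fin n → ℝ) :
    Matrix (Fin n) (Fin n) ℝ :=
  Matrix.diagonal x * A * Matrix.diagonal y

/-- A square matrix `A` is asymptotically `(r, c)`-scalable if there is a sequence of pairs of
positive vectors such that the row sums and the column sums of the scaled matrices converge to
`r` and to `c`. -/
def AsymptoticallyScalable {n : ℕ} (A : Matrix (Fin n) (Fin n) ℝ) (r c : Fin n → ℝ) : Prop :=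
  ∃ x y : ℕ → Fin n → ℝ,
    (∀ k i, 0 < x k i) ∧ (∀ k j, 0 < y k j) ∧
    Tendsto (fun k => scaledMatrix A (x k) (y k) *ᵥ 1) atTop (𝓝 r) ∧
    Tendsto (fun k => (scaledMatrix A (x k) (y k))ᵀ *ᵥ 1) atTop (𝓝 c)

/-- The bit complexity `L_A` of a nonnegative matrix: the maximum of `|log A i j|` over the nonzero
entries (and `0` if there are none). -/
noncomputable def bitComplexity {n : ℕ} (A : Matrix (Fin n) (Fin n) ℝ) : ℝ :=
  sSup {t : ℝ | ∃ i j, A i j ≠ 0 ∧ t = |Real.log (A i j)|}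

/-! A limit point of the scaled matrices is a nonnegative matrix with marginals `r`, `c` that
vanishes wherever `A` does. Among such matrices take `P` with the largest support `S`; as the
marginals are integers, Birkhoff's theorem allows nonzero entries at least `1 / n ^ 2`
(`exists_max_support_of_integral_marginals`).

On `S` the matrix `A` scales exactly: minimise the sum over `S` of `A * exp (u + v) - P * (u + v)`,
whose critical points have the marginals of `P`. The lower bound on `P` bounds every `u i + v j`
polynomially (`abs_le_of_exact_scaling`), and normalising on each component of the bipartite graph
`S` bounds `u` and `v` separately.

Entries of `A` outside `S` are damped by a potential `φ ≤ 2 * n`, constant across edges of `S` and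
dropping by at least 1 across all other edges of `A`; it exists because `S` is maximal
(`exists_potential_of_max_support`). Replacing `u`, `v` by `u - M * φ`, `v + M * φ` preserves the
entries on `S` and multiplies the others by at most `exp (-M)`. An `M` polynomial in the data
suffices. -/

/-! ### Integral marginals and maximal support -/

/-- Any edge used by a nonnegative matrix with integral marginals is used with weight at least `1`
by a matrix with the same marginals and no larger support. -/
theorem exists_one_le_of_pos_of_integral_marginals {ι κ : Type*} [Fintype ι] [Fintype κ]
    {P : ι → κ → ℝ} {r : ι → ℕ} {c : κ → ℕ} (hP : ∀ i j, 0 ≤ P i j)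
    (hr : ∀ i, ∑ j, P i j = r i) (hc : ∀ j, ∑ i, P i j = c j) {i₀ : ι} {j₀ : κ}
    (h₀ : 0 < P i₀ j₀) :
    ∃ Q : ι → κ → ℝ, (∀ i j, 0 ≤ Q i j) ∧ (∀ i, ∑ j, Q i j = r i) ∧
      (∀ j, ∑ i, Q i j = c j) ∧ (∀ i j, P i j = 0 → Q i j = 0) ∧ 1 ≤ Q i₀ j₀ := by
  classical
  have hPr : ∀ i j, P i j ≤ r i := fun i j =>
    (Finset.single_le_sum (fun j _ => hP i j) (Finset.mem_univ j)).trans_eq (hr i)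
  have hPc : ∀ i j, P i j ≤ c j := fun i j =>
    (Finset.single_le_sum (f := fun i => P i j) (fun i _ => hP i j)
      (Finset.mem_univ i)).trans_eq (hc j)
  have hcard : Fintype.card (Σ i, Fin (r i)) = Fintype.card (Σ j, Fin (c j)) := by
    simp only [Fintype.card_sigma, Fintype.card_fin]
    have : (∑ i, (r i : ℝ)) = ∑ j, (c j : ℝ) := by
      simp_rw [← hr, ← hc]; exact Finset.sum_comm
    exact_mod_cast this
  -- Split row `i` into `r i` copies and column `j` into `c j` copies, spreading `P i j` evenly over
  -- the copies. The result is doubly stochastic; zero marginals simply have no copies.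
  let e : (Σ i, Fin (r i)) ≃ (Σ j, Fin (c j)) := Fintype.equivOfCardEq hcard
  let M : Matrix (Σ i, Fin (r i)) (Σ i, Fin (r i)) ℝ :=
    fun a b => P a.1 (e b).1 / (r a.1 * c (e b).1)
  have hM : M ∈ doublyStochastic ℝ (Σ i, Fin (r i)) := by
    rw [mem_doublyStochastic_iff_sum]
    refine ⟨fun a b => div_nonneg (hP _ _) (by positivity), fun a => ?_, fun b => ?_⟩
    · have hra : (r a.1 : ℝ) ≠ 0 := by
        have := a.2.pos; positivity
      have h1 : ∀ j, (∑ _k : Fin (c j), P a.1 j / (r a.1 * c j)) = P a.1 j / r a.1 := by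
        intro j
        simp only [Finset.sum_const, Finset.card_univ, Fintype.card_fin, nsmul_eq_mul]
        by_cases hj : (c j : ℝ) = 0
        · have : P a.1 j = 0 := le_antisymm ((hPc _ _).trans_eq hj) (hP _ _)
          simp [this]
        · field_simp
      calc ∑ b, M a b = ∑ b : Σ j, Fin (c j), P a.1 b.1 / (r a.1 * c b.1) :=
            Equiv.sum_comp e fun b => P a.1 b.1 / (r a.1 * c b.1)
        _ = 1 := by
          rw [Fintype.sum_sigma]
          simp only [h1]
          rw [← Finset.sum_div, hr, div_self hra]
    · have hcb : (c (e b).1 : ℝ) ≠ 0 := by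
        have := (e b).2.pos; positivity
      have h1 : ∀ i, (∑ _k : Fin (r i), P i (e b).1 / (r i * c (e b).1))
          = P i (e b).1 / c (e b).1 := by
        intro i
        simp only [Finset.sum_const, Finset.card_univ, Fintype.card_fin, nsmul_eq_mul]
        by_cases hi : (r i : ℝ) = 0
        · have : P i (e b).1 = 0 := le_antisymm ((hPr _ _).trans_eq hi) (hP _ _)
          simp [this]
        · field_simp
      calc ∑ a, M a b = ∑ a : Σ i, Fin (r i), P a.1 (e b).1 / (r a.1 * c (e b).1) := rfl
        _ = 1 := by
          rw [Fintype.sum_sigma]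
          simp only [h1]
          rw [← Finset.sum_div, hc, div_self hcb]
  obtain ⟨w, hw0, -, hwM⟩ := exists_eq_sum_perm_of_mem_doublyStochastic hM
  have happ : ∀ a b, M a b = ∑ σ, w σ * (σ.permMatrix ℝ) a b := by
    intro a b
    rw [← hwM, Matrix.sum_apply]
    simp
  have hr₀ : 0 < r i₀ := by exact_mod_cast h₀.trans_le (hPr i₀ j₀)
  have hc₀ : 0 < c j₀ := by exact_mod_cast h₀.trans_le (hPc i₀ j₀)
  let a₀ : Σ i, Fin (r i) := ⟨i₀, ⟨0, hr₀⟩⟩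
  let b₀ : Σ i, Fin (r i) := e.symm ⟨j₀, ⟨0, hc₀⟩⟩
  have hM₀ : M a₀ b₀ ≠ 0 := by
    simp only [M, b₀, Equiv.apply_symm_apply, a₀]
    positivity
  -- Some permutation of positive weight in the Birkhoff decomposition passes through the chosen
  -- entry.
  obtain ⟨σ, -, hσ⟩ := Finset.exists_ne_zero_of_sum_ne_zero (happ a₀ b₀ ▸ hM₀)
  have hwσ : 0 < w σ := lt_of_le_of_ne (hw0 σ) (left_ne_zero_of_mul hσ).symm
  have hσ₀ : σ a₀ = b₀ := by
    have h2 := right_ne_zero_of_mul hσ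
    by_contra hne
    exact h2 (by simp [Equiv.Perm.permMatrix, PEquiv.toMatrix_apply, hne])
  have hsupp : ∀ a, P a.1 (e (σ a)).1 ≠ 0 := by
    intro a h
    have h1 : M a (σ a) = 0 := by simp [M, h]
    rw [happ] at h1
    have h2 := (Finset.sum_eq_zero_iff_of_nonneg (fun τ _ => mul_nonneg (hw0 τ) (by
      simp only [Equiv.Perm.permMatrix, PEquiv.toMatrix_apply]; split_ifs <;> norm_num))).1 h1
      σ (Finset.mem_univ _)
    simp [Equiv.Perm.permMatrix, PEquiv.toMatrix_apply] at h2
    exact hwσ.ne' h2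
  -- `Q i j` counts the copies of row `i` that `σ` matches to copies of column `j`.
  refine ⟨fun i j => ∑ a : Σ i, Fin (r i),
    if a.1 = i ∧ (e (σ a)).1 = j then (1 : ℝ) else 0, ?_, ?_, ?_, ?_, ?_⟩
  · intro i j
    exact Finset.sum_nonneg fun a _ => by split_ifs <;> norm_num
  · intro i
    rw [Finset.sum_comm]
    simp only [ite_and, Finset.sum_ite_irrel, Finset.sum_ite_eq, Finset.mem_univ, if_true,
      Finset.sum_const_zero]
    rw [Fintype.sum_sigma]
    refine (Finset.sum_congr rfl fun x _ => (?_ : _ = if x = i then (r x : ℝ) else 0)).trans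
      (by simp)
    by_cases h : x = i
    · subst h; simp
    · simp [h]
  · intro j
    rw [Finset.sum_comm]
    simp only [ite_and, Finset.sum_ite_eq, Finset.mem_univ, if_true]
    refine (Equiv.sum_comp (σ.trans e) fun b => if b.1 = j then (1 : ℝ) else 0).trans ?_
    rw [Fintype.sum_sigma]
    refine (Finset.sum_congr rfl fun x _ => (?_ : _ = if x = j then (c x : ℝ) else 0)).trans
      (by simp)
    by_cases h : x = j
    · subst h; simp
    · simp [h]
  · intro i j hij
    refine Finset.sum_eq_zero fun a _ => if_neg ?_
    rintro ⟨rfl, rfl⟩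
    exact hsupp a hij
  · refine le_trans ?_ (Finset.single_le_sum (f := fun a : Σ i, Fin (r i) =>
      if a.1 = i₀ ∧ (e (σ a)).1 = j₀ then (1 : ℝ) else 0)
      (fun a _ => by split_ifs <;> norm_num) (Finset.mem_univ a₀))
    simp [hσ₀, a₀, b₀]

/-- There is a matrix with given integral marginals, supported in `E`, that has the largest possible
support and whose nonzero entries are bounded below. -/
theorem exists_max_support_of_integral_marginals {ι κ : Type*} [Fintype ι] [Fintype κ]
    (E : ι → κ → Prop) {P : ι → κ → ℝ} {r : ι → ℕ} {c : κ → ℕ} (hP : ∀ i j, 0 ≤ P i j)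
    (hE : ∀ i j, P i j ≠ 0 → E i j)
    (hr : ∀ i, ∑ j, P i j = r i) (hc : ∀ j, ∑ i, P i j = c j) :
    ∃ Q : ι → κ → ℝ, (∀ i j, 0 ≤ Q i j) ∧ (∀ i j, Q i j ≠ 0 → E i j) ∧
      (∀ i, ∑ j, Q i j = r i) ∧ (∀ j, ∑ i, Q i j = c j) ∧
      (∀ i j, 0 < Q i j → 1 ≤ (Fintype.card ι * Fintype.card κ : ℝ) * Q i j) ∧
      ∀ R : ι → κ → ℝ, (∀ i j, 0 ≤ R i j) → (∀ i j, R i j ≠ 0 → E i j) →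
        (∀ i, ∑ j, R i j = r i) → (∀ j, ∑ i, R i j = c j) → ∀ i j, 0 < R i j → 0 < Q i j := by
  classical
  let K : Set (ι → κ → ℝ) := {R | (∀ i j, 0 ≤ R i j) ∧ (∀ i j, R i j ≠ 0 → E i j) ∧
    (∀ i, ∑ j, R i j = r i) ∧ (∀ j, ∑ i, R i j = c j)}
  have key : ∀ p : ι × κ, ∃ R ∈ K, (∃ S ∈ K, 0 < S p.1 p.2) → 1 ≤ R p.1 p.2 := by
    intro p
    by_cases h : ∃ S ∈ K, 0 < S p.1 p.2
    · obtain ⟨S, ⟨h1, h2, h3, h4⟩, hS⟩ := h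
      obtain ⟨R, k1, k2, k3, k4, k5⟩ := exists_one_le_of_pos_of_integral_marginals h1 h3 h4 hS
      exact ⟨R, ⟨k1, fun i j hR => h2 i j fun h0 => hR (k4 i j h0), k2, k3⟩, fun _ => k5⟩
    · exact ⟨P, ⟨hP, hE, hr, hc⟩, fun h' => absurd h' h⟩
  choose R hRK hR using key
  rcases isEmpty_or_nonempty (ι × κ) with hem | hne
  · exact ⟨P, hP, hE, hr, hc, fun i j => (hem.false (i, j)).elim,
      fun _ _ _ _ _ i j => (hem.false (i, j)).elim⟩
  -- The average of the matrices `R p` over all positions `p` has every attainable entry at least `1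
  -- / N`.
  let N : ℝ := Fintype.card (ι × κ)
  have hN : 0 < N := by simp only [N]; exact_mod_cast Fintype.card_pos
  have hNQ : ∀ i j, N * ((∑ p, R p i j) / N) = ∑ p, R p i j := fun i j => by field_simp
  have hone : ∀ i j S, S ∈ K → 0 < S i j → 1 ≤ N * ((∑ p, R p i j) / N) := by
    intro i j S hS hpos
    rw [hNQ]
    exact (hR (i, j) ⟨S, hS, hpos⟩).trans (Finset.single_le_sum (f := fun p => R p i j)
      (fun p _ => (hRK p).1 i j) (Finset.mem_univ (i, j)))
  have hQK : (fun i j => (∑ p, R p i j) / N) ∈ K := by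
    refine ⟨fun i j => div_nonneg (Finset.sum_nonneg fun p _ => (hRK p).1 i j) hN.le, ?_, ?_, ?_⟩
    · intro i j h
      obtain ⟨p, -, hp⟩ := Finset.exists_ne_zero_of_sum_ne_zero 
        (fun h0 : ∑ p, R p i j = 0 => h (by simp [h0]))
      exact (hRK p).2.1 i j hp
    · intro i
      rw [← Finset.sum_div, Finset.sum_comm, Finset.sum_congr rfl fun p _ => (hRK p).2.2.1 i]
      simp only [Finset.sum_const, Finset.card_univ, nsmul_eq_mul]
      exact mul_div_cancel_left₀ _ hN.ne'
    · intro j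
      rw [← Finset.sum_div, Finset.sum_comm, Finset.sum_congr rfl fun p _ => (hRK p).2.2.2 j]
      simp only [Finset.sum_const, Finset.card_univ, nsmul_eq_mul]
      exact mul_div_cancel_left₀ _ hN.ne'
  refine ⟨_, hQK.1, hQK.2.1, hQK.2.2.1, hQK.2.2.2, ?_, ?_⟩
  · intro i j h
    have := hone i j _ hQK h
    simpa [N, Fintype.card_prod] using this
  · intro S h1 h2 h3 h4 i j h
    have := hone i j S ⟨h1, h2, h3, h4⟩ h
    exact pos_of_mul_pos_right (one_pos.trans_le this) hN.le

/-! ### Residual digraph and potential -/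

/-- The residual digraph of a flow `P` in a bipartite graph `E`: edges of `E` may be used forwards,
edges carrying flow may be used backwards. -/
def ResidualStep {ι κ : Type*} (E : ι → κ → Prop) (P : ι → κ → ℝ) : ι ⊕ κ → ι ⊕ κ → Prop
  | .inl i, .inr j => E i j
  | .inr j, .inl i => 0 < P i j
  | _, _ => False

/-- `D` is the signed count of the steps of the path, `+1` forwards and `-1` backwards. Its
divergence telescopes to the endpoints, and it can be negative only where there is flow to cancel.
-/
theorem exists_augmentation_of_residual_path {ι κ : Type*} [Fintype ι] [Fintype κ] [DecidableEq ι]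
    [DecidableEq κ] {E : ι → κ → Prop} {P : ι → κ → ℝ} (hE : ∀ i j, 0 < P i j → E i j)
    {a b : ι ⊕ κ} (h : Relation.ReflTransGen (ResidualStep E P) a b) :
    ∃ D : ι → κ → ℝ, (∀ i j, D i j ≠ 0 → E i j) ∧ (∀ i j, ¬ 0 < P i j → 0 ≤ D i j) ∧
      (∀ i, ∑ j, D i j = Pi.single (M := fun _ => ℝ) a 1 (.inl i)
        - Pi.single (M := fun _ => ℝ) b 1 (.inl i)) ∧
      (∀ j, -∑ i, D i j = Pi.single (M := fun _ => ℝ) a 1 (.inr j)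
        - Pi.single (M := fun _ => ℝ) b 1 (.inr j)) := by
  induction h with
  | refl => exact ⟨0, by simp⟩
  | @tail b d _ hs ih =>
    obtain ⟨D, h1, h2, h3, h4⟩ := ih
    match b, d, hs with
    | .inl i₀, .inr j₀, hs =>
      change E i₀ j₀ at hs
      refine ⟨fun i j => D i j + if i = i₀ ∧ j = j₀ then 1 else 0, ?_, ?_, ?_, ?_⟩
      · intro i j h
        by_cases hij : i = i₀ ∧ j = j₀
        · rw [hij.1, hij.2]; exact hs
        · exact h1 i j (by simpa [hij] using h)
      · intro i j h
        exact add_nonneg (h2 i j h) (by split_ifs <;> norm_num)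
      · intro i
        rw [Finset.sum_add_distrib, h3]
        by_cases hi : i = i₀ <;> simp [hi, Pi.single_apply]
      · intro j
        rw [Finset.sum_add_distrib, neg_add, h4]
        by_cases hj : j = j₀ <;> simp [hj, Pi.single_apply]; ring
    | .inr j₀, .inl i₀, hs =>
      change 0 < P i₀ j₀ at hs
      refine ⟨fun i j => D i j - if i = i₀ ∧ j = j₀ then 1 else 0, ?_, ?_, ?_, ?_⟩
      · intro i j h
        by_cases hij : i = i₀ ∧ j = j₀
        · rw [hij.1, hij.2]; exact hE _ _ hs
        · exact h1 i j (by simpa [hij] using h)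
      · intro i j h
        have hij : ¬ (i = i₀ ∧ j = j₀) := by rintro ⟨rfl, rfl⟩; exact h hs
        simpa [hij] using h2 i j h
      · intro i
        rw [Finset.sum_sub_distrib, h3]
        by_cases hi : i = i₀ <;> simp [hi, Pi.single_apply]
      · intro j
        rw [Finset.sum_sub_distrib, neg_sub', h4]
        by_cases hj : j = j₀ <;> simp [hj, Pi.single_apply]

/-- If a flow has the largest possible support, no residual path runs back along an edge that
carries no flow. -/
theorem pos_of_residual_path {ι κ : Type*} [Fintype ι] [Fintype κ] {E : ι → κ → Prop}
    {P : ι → κ → ℝ} (hP : ∀ i j, 0 ≤ P i j) (hE : ∀ i j, P i j ≠ 0 → E i j)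
    (hmax : ∀ R : ι → κ → ℝ, (∀ i j, 0 ≤ R i j) → (∀ i j, R i j ≠ 0 → E i j) →
        (∀ i, ∑ j, R i j = ∑ j, P i j) → (∀ j, ∑ i, R i j = ∑ i, P i j) →
        ∀ i j, 0 < R i j → 0 < P i j)
    {i₀ : ι} {j₀ : κ} (h₀ : E i₀ j₀)
    (h : Relation.ReflTransGen (ResidualStep E P) (.inr j₀) (.inl i₀)) : 0 < P i₀ j₀ := by
  classical
  by_contra hn
  obtain ⟨D', h1', h2', h3', h4'⟩ := exists_augmentation_of_residual_path
    (fun i j hij => hE i j hij.ne') h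
  -- Closing the path with the edge `(i₀, j₀)` gives a circulation; a small multiple of it can be
  -- added to `P`, enlarging the support.
  let F : ι → κ → ℝ := fun i j => D' i j + if i = i₀ ∧ j = j₀ then 1 else 0
  have hF0 : ∀ i j, ¬ 0 < P i j → 0 ≤ F i j := fun i j hij =>
    add_nonneg (h2' i j hij) (by split_ifs <;> norm_num)
  have hFE : ∀ i j, F i j ≠ 0 → E i j := by
    intro i j hF
    by_cases hij : i = i₀ ∧ j = j₀
    · rw [hij.1, hij.2]; exact h₀
    · exact h1' i j (by simpa [F, hij] using hF)
  have hFr : ∀ i, ∑ j, F i j = 0 := by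
    intro i
    simp only [F]
    rw [Finset.sum_add_distrib, h3']
    by_cases hi : i = i₀ <;> simp [hi]
  have hFc : ∀ j, ∑ i, F i j = 0 := by
    intro j
    simp only [F]
    rw [Finset.sum_add_distrib, ← neg_neg (∑ i, D' i j), h4']
    by_cases hj : j = j₀ <;> simp [hj]
  have hδ : ∃ δ : ℝ, 0 < δ ∧ ∀ i j, 0 ≤ P i j + δ * F i j := by
    have : ∀ᶠ δ in 𝓝[>] (0 : ℝ), ∀ i j, 0 ≤ P i j + δ * F i j := by
      refine eventually_all.2 fun i => eventually_all.2 fun j => ?_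
      by_cases hij : 0 < P i j
      · have ht : Tendsto (fun δ : ℝ => P i j + δ * F i j) (𝓝[>] 0) (𝓝 (P i j + 0 * F i j)) :=
          (Continuous.tendsto (by fun_prop) 0).mono_left nhdsWithin_le_nhds
        exact (ht.eventually (lt_mem_nhds (by simpa using hij))).mono fun δ h => h.le
      · filter_upwards [self_mem_nhdsWithin] with δ hδ
        exact add_nonneg (hP i j) (mul_nonneg (le_of_lt hδ) (hF0 i j hij))
    obtain ⟨δ, h1, h2⟩ := (this.and self_mem_nhdsWithin).exists
    exact ⟨δ, h2, h1⟩
  obtain ⟨δ, hδ0, hδ⟩ := hδ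
  refine hn (hmax (fun i j => P i j + δ * F i j) hδ ?_ ?_ ?_ i₀ j₀ ?_)
  · intro i j hij
    by_contra hne
    have e1 : P i j = 0 := by_contra fun h => hne (hE i j h)
    have e2 : F i j = 0 := by_contra fun h => hne (hFE i j h)
    exact hij (by simp [e1, e2])
  · intro i
    rw [Finset.sum_add_distrib, ← Finset.mul_sum, hFr]; ring
  · intro j
    rw [Finset.sum_add_distrib, ← Finset.mul_sum, hFc]; ring
  · have : 1 ≤ F i₀ j₀ := by simpa [F] using h2' i₀ j₀ hn
    have := hP i₀ j₀
    have : 0 < δ * F i₀ j₀ := by positivity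
    linarith

/-- A potential that is constant along edges carrying flow and drops along all others. -/
theorem exists_potential_of_max_support {ι κ : Type*} [Fintype ι] [Fintype κ] {E : ι → κ → Prop}
    {P : ι → κ → ℝ} (hP : ∀ i j, 0 ≤ P i j) (hE : ∀ i j, P i j ≠ 0 → E i j)
    (hmax : ∀ R : ι → κ → ℝ, (∀ i j, 0 ≤ R i j) → (∀ i j, R i j ≠ 0 → E i j) →
        (∀ i, ∑ j, R i j = ∑ j, P i j) → (∀ j, ∑ i, R i j = ∑ i, P i j) →
        ∀ i j, 0 < R i j → 0 < P i j) :
    ∃ φ : ι ⊕ κ → ℕ, (∀ a, φ a ≤ Fintype.card ι + Fintype.card κ) ∧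
      (∀ i j, 0 < P i j → φ (.inl i) = φ (.inr j)) ∧
      (∀ i j, E i j → ¬ 0 < P i j → φ (.inr j) + 1 ≤ φ (.inl i)) := by
  classical
  let reach : ι ⊕ κ → Finset (ι ⊕ κ) := fun a =>
    {b | Relation.ReflTransGen (ResidualStep E P) a b}
  have hmono : ∀ a b, ResidualStep E P a b → reach b ⊆ reach a := by
    intro a b hab d hd
    simp only [reach, Finset.mem_filter, Finset.mem_univ, true_and] at hd ⊢
    exact hd.head hab
  -- Reachable sets shrink along residual steps. A flow edge is a step both ways, so its ends reach
  -- the same set; across any other edge of `E` the tail is lost, by `pos_of_residual_path`.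
  refine ⟨fun a => (reach a).card, fun a => ?_, fun i j hij => ?_, fun i j hij hn => ?_⟩
  · rw [← Fintype.card_sum]; exact Finset.card_le_univ _
  · have h1 := hmono (.inl i) (.inr j) (hE i j hij.ne')
    have h2 := hmono (.inr j) (.inl i) hij
    exact congrArg Finset.card (h2.antisymm h1)
  · refine Finset.card_lt_card ⟨hmono (.inl i) (.inr j) hij, fun hsub => hn ?_⟩
    have : Sum.inl i ∈ reach (.inr j) := hsub (by simp [reach, Relation.ReflTransGen.refl])
    exact pos_of_residual_path hP hE hmax hij (by simpa [reach] using this)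

/-! ### Exact scaling on the support -/

/-- Bound `a * exp w` below by its tangent of slope `2 * p`, attained at `w = s`. After subtracting
`p * w` a growth of `p * |w|` is left for `w ≥ 0`; for `w < 0` the linear term alone suffices. -/
theorem mul_abs_sub_le_mul_exp_sub {a p w : ℝ} (ha : 0 < a) (hp : 0 < p) :
    p * |w| - 2 * p * |1 - Real.log (2 * p / a)| ≤ a * Real.exp w - p * w := by
  set s := Real.log (2 * p / a)
  have hs : Real.exp s = 2 * p / a := Real.exp_log (by positivity)
  have h1 : w - s + 1 ≤ Real.exp (w - s) := Real.add_one_le_exp _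
  have h2 : Real.exp w = 2 * p / a * Real.exp (w - s) := by
    rw [← hs, ← Real.exp_add]; ring_nf
  have h3 : a * Real.exp w = 2 * p * Real.exp (w - s) := by rw [h2]; field_simp
  have h4 : 2 * p * (w - s + 1) ≤ a * Real.exp w := by rw [h3]; gcongr
  have h5 : -(2 * p * |1 - s|) ≤ 2 * p * (1 - s) := by
    have := mul_le_mul_of_nonneg_left (neg_abs_le (1 - s)) (by positivity : 0 ≤ 2 * p)
    linarith
  have h6 : 0 ≤ 2 * p * |1 - s| := by positivity
  rcases abs_cases w with ⟨h, _⟩ | ⟨h, _⟩ <;> rw [h]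
  · linarith
  · have : 0 < a * Real.exp w := by positivity
    linarith

/-- The scaling potential attains its minimum on any linear family of exponents. -/
theorem exists_min_sum_mul_exp_sub {τ : Type*} [Fintype τ] {a p : τ → ℝ} (ha : ∀ t, 0 < a t)
    (hp : ∀ t, 0 < p t) (V : Submodule ℝ (τ → ℝ)) :
    ∃ w ∈ V, ∀ z ∈ V, ∑ t, (a t * Real.exp (w t) - p t * w t) ≤
      ∑ t, (a t * Real.exp (z t) - p t * z t) := by
  let g : (τ → ℝ) → ℝ := fun w => ∑ t, (a t * Real.exp (w t) - p t * w t)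
  have hg : Continuous g := by fun_prop
  let C : ℝ := ∑ t, 2 * p t * |1 - Real.log (2 * p t / a t)|
  have hcoer : ∀ w : τ → ℝ, (∑ t, p t * |w t|) - C ≤ g w := by
    intro w
    simp only [C, g]
    rw [← Finset.sum_sub_distrib]
    exact Finset.sum_le_sum fun t _ => mul_abs_sub_le_mul_exp_sub (ha t) (hp t)
  let K : Set (τ → ℝ) := Set.univ.pi fun t => Set.Icc (-((g 0 + C) / p t)) ((g 0 + C) / p t)
  have hK : IsCompact K := isCompact_univ_pi fun t => isCompact_Icc
  have hsub : ∀ w, g w ≤ g 0 → w ∈ K := by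
    intro w hw t _
    have h1 : p t * |w t| ≤ ∑ t, p t * |w t| :=
      Finset.single_le_sum (f := fun t => p t * |w t|)
        (fun t _ => mul_nonneg (hp t).le (abs_nonneg _)) (Finset.mem_univ t)
    have h2 := hcoer w
    rw [Set.mem_Icc, ← abs_le, le_div_iff₀ (hp t)]
    linarith
  have hV : IsClosed (V : Set (τ → ℝ)) := V.closed_of_finiteDimensional
  obtain ⟨w, ⟨hwK, hwV⟩, hw⟩ := (hK.inter_right hV).exists_isMinOn
    ⟨0, hsub 0 le_rfl, V.zero_mem⟩ hg.continuousOn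
  refine ⟨w, hwV, fun z hz => ?_⟩
  by_cases h : g z ≤ g 0
  · exact hw ⟨hsub z h, hz⟩
  · exact (hw ⟨hsub 0 le_rfl, V.zero_mem⟩ : g w ≤ g 0).trans (not_le.1 h).le

/-- A positive matrix on the support of `P` can be scaled to the marginals of `P`, by a minimiser of
the scaling potential. -/
theorem exists_exact_scaling {ι κ : Type*} [Fintype ι] [Fintype κ] (S : Finset (ι × κ))
    {A P : ι × κ → ℝ} (hA : ∀ p ∈ S, 0 < A p) (hP : ∀ p ∈ S, 0 < P p) :
    ∃ (u : ι → ℝ) (v : κ → ℝ),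
      (∀ (u' : ι → ℝ) (v' : κ → ℝ),
        ∑ p ∈ S, (A p * Real.exp (u p.1 + v p.2) - P p * (u p.1 + v p.2)) ≤
          ∑ p ∈ S, (A p * Real.exp (u' p.1 + v' p.2) - P p * (u' p.1 + v' p.2))) ∧
      ∀ (u' : ι → ℝ) (v' : κ → ℝ),
        ∑ p ∈ S, A p * Real.exp (u p.1 + v p.2) * (u' p.1 + v' p.2) =
          ∑ p ∈ S, P p * (u' p.1 + v' p.2) := by
  -- The potential is not coercive in `(u, v)`, where opposite constant shifts of `u` and `v` change
  -- nothing, but it is in the exponents `u i + v j`, so the minimum is taken over the range of `T`.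
  let T : ((ι → ℝ) × (κ → ℝ)) →ₗ[ℝ] (S → ℝ) :=
    { toFun := fun z p => z.1 p.1.1 + z.2 p.1.2
      map_add' := fun x y => by ext p; simp; ring
      map_smul' := fun m x => by ext p; simp; ring }
  obtain ⟨w, ⟨⟨u, v⟩, rfl⟩, hw⟩ := exists_min_sum_mul_exp_sub (τ := S)
    (a := fun p => A p) (p := fun p => P p) (fun t => hA t t.2) (fun t => hP t t.2)
    (LinearMap.range T)
  have hmin : ∀ (u' : ι → ℝ) (v' : κ → ℝ),
        ∑ p ∈ S, (A p * Real.exp (u p.1 + v p.2) - P p * (u p.1 + v p.2)) ≤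
          ∑ p ∈ S, (A p * Real.exp (u' p.1 + v' p.2) - P p * (u' p.1 + v' p.2)) := by
    intro u' v'
    have := hw (T (u', v')) ⟨_, rfl⟩
    rw [← Finset.sum_coe_sort S, ← Finset.sum_coe_sort S]
    exact this
  refine ⟨u, v, hmin, fun u' v' => ?_⟩
  -- The derivative at the minimiser in the direction `(u', v')` vanishes.
  let F : ℝ → ℝ := fun s => ∑ p ∈ S, (A p * Real.exp ((u p.1 + v p.2) + s * (u' p.1 + v' p.2))
    - P p * ((u p.1 + v p.2) + s * (u' p.1 + v' p.2)))
  have hF : HasDerivAt F (∑ p ∈ S, (A p * (Real.exp ((u p.1 + v p.2) + 0 * (u' p.1 + v' p.2))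
      * (u' p.1 + v' p.2)) - P p * (u' p.1 + v' p.2))) 0 := by
    refine HasDerivAt.fun_sum fun p _ => ?_
    have h1 : HasDerivAt (fun s : ℝ => (u p.1 + v p.2) + s * (u' p.1 + v' p.2))
        (u' p.1 + v' p.2) 0 := by
      simpa using ((hasDerivAt_id (0 : ℝ)).mul_const (u' p.1 + v' p.2)).const_add (u p.1 + v p.2)
    exact (h1.exp.const_mul (A p)).sub (h1.const_mul (P p))
  have hloc : IsLocalMin F 0 := Filter.Eventually.of_forall fun s => by
    have h1 := hmin (fun i => u i + s * u' i) (fun j => v j + s * v' j)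
    have h2 : ∀ p : ι × κ, u p.1 + s * u' p.1 + (v p.2 + s * v' p.2) =
      u p.1 + v p.2 + s * (u' p.1 + v' p.2) := fun p => by ring
    simp only [h2] at h1
    simpa only [F, zero_mul, add_zero] using h1
  have h0 := IsLocalMin.hasDerivAt_eq_zero hloc hF
  simp only [zero_mul, add_zero] at h0
  rw [Finset.sum_sub_distrib, sub_eq_zero] at h0
  rw [← h0]
  exact Finset.sum_congr rfl fun p _ => by ring

/-! ### Polynomial bounds on the scaling exponents -/

/-- Vertex weights whose increments along the edges of a finite graph are bounded may be shifted on
each component so as to be bounded. -/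
theorem exists_bounded_shift {V : Type*} [Fintype V] (G : SimpleGraph V) (f : V → ℝ) {W : ℝ}
    (hW : 0 ≤ W) (hf : ∀ a b, G.Adj a b → |f a - f b| ≤ W) :
    ∃ s : V → ℝ, (∀ a b, G.Adj a b → s a = s b) ∧ ∀ a, |f a - s a| ≤ Fintype.card V * W := by
  classical
  have hwalk : ∀ a b (p : G.Walk a b), |f a - f b| ≤ p.length * W := by
    intro a b p
    induction p with
    | nil => simp
    | @cons a b d h p ih =>
      calc |f a - f d| ≤ |f a - f b| + |f b - f d| := abs_sub_le _ _ _
        _ ≤ W + p.length * W := add_le_add (hf _ _ h) ih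
        _ = _ := by simp; ring
  -- The shift is the weight of a chosen vertex of the component, joined to `a` by a path of fewer
  -- than `Fintype.card V` edges.
  refine ⟨fun a => f (G.connectedComponentMk a).out, fun a b h => ?_, fun a => ?_⟩
  · exact congrArg (fun C : G.ConnectedComponent => f C.out)
      (SimpleGraph.ConnectedComponent.sound h.reachable)
  · have hr : G.Reachable a (G.connectedComponentMk a).out :=
      SimpleGraph.ConnectedComponent.exact (G.connectedComponentMk a).out_eq.symm
    obtain ⟨p, hp⟩ := hr.exists_isPath
    refine (hwalk _ _ p).trans (mul_le_mul_of_nonneg_right ?_ hW)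
    exact_mod_cast hp.length_lt.le

/-- With weights `u` on rows and `-v` on columns, `u i + v j` is the increment along an edge of the
graph `S`, and shifts constant on components preserve it. -/
theorem exists_bounded_scaling {ι κ : Type*} [Fintype ι] [Fintype κ] (S : Finset (ι × κ))
    (u : ι → ℝ) (v : κ → ℝ) {W : ℝ} (hW : 0 ≤ W) (h : ∀ p ∈ S, |u p.1 + v p.2| ≤ W) :
    ∃ (u' : ι → ℝ) (v' : κ → ℝ), (∀ p ∈ S, u' p.1 + v' p.2 = u p.1 + v p.2) ∧
      (∀ i, |u' i| ≤ (Fintype.card ι + Fintype.card κ) * W) ∧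
      ∀ j, |v' j| ≤ (Fintype.card ι + Fintype.card κ) * W := by
  let G : SimpleGraph (ι ⊕ κ) :=
    SimpleGraph.fromRel fun a b => ∃ p ∈ S, a = .inl p.1 ∧ b = .inr p.2
  let f : ι ⊕ κ → ℝ := Sum.elim u fun j => -v j
  have hf : ∀ a b, G.Adj a b → |f a - f b| ≤ W := by
    rintro a b ⟨-, ⟨p, hp, rfl, rfl⟩ | ⟨p, hp, rfl, rfl⟩⟩
    · simpa [f] using h p hp
    · rw [abs_sub_comm]; simpa [f] using h p hp
  obtain ⟨s, hs, hb⟩ := exists_bounded_shift G f hW hf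
  rw [Fintype.card_sum, Nat.cast_add] at hb
  refine ⟨fun i => u i - s (.inl i), fun j => v j + s (.inr j), fun p hp => ?_,
    fun i => hb (.inl i), fun j => ?_⟩
  · have : s (.inl p.1) = s (.inr p.2) := hs _ _ ⟨by simp, .inl ⟨p, hp, rfl, rfl⟩⟩
    simp only [this]; ring
  · have := hb (.inr j)
    rw [← abs_neg] at this
    refine le_trans (le_of_eq ?_) this
    simp only [f, Sum.elim_inr]; congr 1; ring

/-- Bounds for the exponents of a minimiser of the scaling potential. -/
theorem abs_le_of_exact_scaling {ι κ : Type*} {S : Finset (ι × κ)} {A P : ι × κ → ℝ}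
    {L K H : ℝ} (hA : ∀ p ∈ S, 0 < A p) (hAL : ∀ p ∈ S, |Real.log (A p)| ≤ L)
    (hP : ∀ p ∈ S, 0 < P p) (hPK : ∀ p ∈ S, 1 ≤ K * P p) (hSK : S.card ≤ K)
    (hH : ∑ p ∈ S, P p = H) {u : ι → ℝ} {v : κ → ℝ}
    (hmin : ∀ (u' : ι → ℝ) (v' : κ → ℝ),
        ∑ p ∈ S, (A p * Real.exp (u p.1 + v p.2) - P p * (u p.1 + v p.2)) ≤
          ∑ p ∈ S, (A p * Real.exp (u' p.1 + v' p.2) - P p * (u' p.1 + v' p.2)))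
    (hmarg : ∀ (u' : ι → ℝ) (v' : κ → ℝ),
        ∑ p ∈ S, A p * Real.exp (u p.1 + v p.2) * (u' p.1 + v' p.2) =
          ∑ p ∈ S, P p * (u' p.1 + v' p.2)) {q : ι × κ} (hq : q ∈ S) :
    |u q.1 + v q.2| ≤ H + L + K * (K + 2 * H * L + H ^ 2) := by
  classical
  have hL : 0 ≤ L := (abs_nonneg _).trans (hAL q hq)
  have hH0 : 0 < H := hH ▸ Finset.sum_pos hP ⟨q, hq⟩
  have hK : 0 ≤ K := (Nat.cast_nonneg _).trans hSK
  have hsum : ∑ p ∈ S, A p * Real.exp (u p.1 + v p.2) = H := by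
    have := hmarg (fun _ => 1) (fun _ => 0)
    simpa [hH] using this
  have hupper : ∀ p ∈ S, u p.1 + v p.2 ≤ H + L := by
    intro p hp
    have h1 : A p * Real.exp (u p.1 + v p.2) ≤ H := by
      rw [← hsum]
      exact Finset.single_le_sum (f := fun p : ι × κ => A p * Real.exp (u p.1 + v p.2))
        (fun p hp => (mul_pos (hA p hp) (Real.exp_pos _)).le) hp
    have h2 := Real.log_le_log (mul_pos (hA p hp) (Real.exp_pos _)) h1
    rw [Real.log_mul (hA p hp).ne' (Real.exp_pos _).ne', Real.log_exp] at h2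
    have h3 := Real.log_le_sub_one_of_pos hH0
    have h4 := (abs_le.1 (hAL p hp)).1
    linarith
  -- Competitor in the minimisation: scaling by `exp (-L)` makes every entry at most 1.
  have hcomp : ∑ p ∈ S, (A p * Real.exp (u p.1 + v p.2) - P p * (u p.1 + v p.2)) ≤ K + H * L := by
    refine (hmin (fun _ => -L) (fun _ => 0)).trans ?_
    calc ∑ p ∈ S, (A p * Real.exp (-L + 0) - P p * (-L + 0)) ≤ ∑ p ∈ S, (1 + P p * L) := by
          refine Finset.sum_le_sum fun p hp => ?_
          have h1 : A p ≤ Real.exp L := by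
            rw [← Real.exp_log (hA p hp)]
            exact Real.exp_le_exp.2 (abs_le.1 (hAL p hp)).2
          have h2 : A p * Real.exp (-L) ≤ 1 := by
            calc A p * Real.exp (-L) ≤ Real.exp L * Real.exp (-L) := by gcongr
              _ = 1 := by rw [← Real.exp_add]; simp
          rw [add_zero]; linarith
      _ = S.card + H * L := by
          rw [Finset.sum_add_distrib, ← Finset.sum_mul, hH]; simp
      _ ≤ K + H * L := by linarith
  -- Drop the exponentials and use the upper bound on every exponent except that of `q`; only `-P q
  -- * (u q.1 + v q.2)` can then be large.
  have hlow : ∑ p ∈ S, (if p = q then -(P q * (u q.1 + v q.2)) else 0) - ∑ p ∈ S, P p * (H + L) ≤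
      ∑ p ∈ S, (A p * Real.exp (u p.1 + v p.2) - P p * (u p.1 + v p.2)) := by
    rw [← Finset.sum_sub_distrib]
    refine Finset.sum_le_sum fun p hp => ?_
    have h1 := mul_pos (hA p hp) (Real.exp_pos (u p.1 + v p.2))
    split_ifs with h
    · subst h
      have : 0 ≤ P p * (H + L) := mul_nonneg (hP p hp).le (by linarith)
      linarith
    · have := mul_le_mul_of_nonneg_left (hupper p hp) (hP p hp).le
      linarith
  rw [Finset.sum_ite_eq' S q, if_pos hq, ← Finset.sum_mul, hH] at hlow
  have h5 : P q * -(u q.1 + v q.2) ≤ K + 2 * H * L + H ^ 2 := by nlinarith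
  have h6 : 0 ≤ K * (K + 2 * H * L + H ^ 2) := by positivity
  rw [abs_le]
  refine ⟨?_, by linarith [hupper q hq]⟩
  by_cases hneg : 0 ≤ u q.1 + v q.2
  · linarith
  · have h7 := mul_le_mul_of_nonneg_left h5 hK
    have h8 := mul_le_mul_of_nonneg_right (hPK q hq) (by linarith : 0 ≤ -(u q.1 + v q.2))
    linarith

/-! ### Limit flow, damping and assembly -/

/-- The entries of the scaled matrices are eventually bounded by their row sums, so a subsequence
converges entrywise; zeros of `A` survive in the limit. -/
theorem exists_flow_of_asymptoticallyScalable {n : ℕ} {A : Matrix (Fin n) (Fin n) ℝ}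
    {r c : Fin n → ℝ} (hA : ∀ i j, 0 ≤ A i j) (h : AsymptoticallyScalable A r c) :
    ∃ P : Fin n → Fin n → ℝ, (∀ i j, 0 ≤ P i j) ∧ (∀ i j, P i j ≠ 0 → 0 < A i j) ∧
      (∀ i, ∑ j, P i j = r i) ∧ ∀ j, ∑ i, P i j = c j := by
  obtain ⟨x, y, hx, hy, hr, hc⟩ := h
  let B : ℕ → Fin n → Fin n → ℝ := fun k i j => x k i * A i j * y k j
  have hB : ∀ k i j, 0 ≤ B k i j := fun k i j =>
    mul_nonneg (mul_nonneg (hx k i).le (hA i j)) (hy k j).le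
  have hr' : ∀ i, Tendsto (fun k => ∑ j, B k i j) atTop (𝓝 (r i)) := by
    intro i
    refine (tendsto_pi_nhds.1 hr i).congr fun k => ?_
    simp [scaledMatrix, Matrix.mulVec, dotProduct, B, Matrix.diagonal_mul, Matrix.mul_diagonal]
  have hc' : ∀ j, Tendsto (fun k => ∑ i, B k i j) atTop (𝓝 (c j)) := by
    intro j
    refine (tendsto_pi_nhds.1 hc j).congr fun k => ?_
    simp [scaledMatrix, Matrix.mulVec, dotProduct, B, Matrix.diagonal_mul, Matrix.mul_diagonal]
  have hK : IsCompact (Set.univ.pi fun i : Fin n => Set.univ.pi fun _ : Fin n =>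
      Set.Icc (0 : ℝ) (r i + 1)) :=
    isCompact_univ_pi fun i => isCompact_univ_pi fun _ => isCompact_Icc
  have hmem : ∀ᶠ k in atTop, B k ∈ Set.univ.pi fun i : Fin n => Set.univ.pi fun _ : Fin n =>
      Set.Icc (0 : ℝ) (r i + 1) := by
    have : ∀ᶠ k in atTop, ∀ i, ∑ j, B k i j < r i + 1 :=
      eventually_all.2 fun i => (hr' i).eventually (gt_mem_nhds (by linarith))
    filter_upwards [this] with k hk i _ j _
    exact ⟨hB k i j, (Finset.single_le_sum (fun j _ => hB k i j) (Finset.mem_univ j)).trans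
      (hk i).le⟩
  obtain ⟨P, -, φ, hφ, hlim⟩ := hK.tendsto_subseq' hmem.frequently
  have hlim' : ∀ i j, Tendsto (fun k => B (φ k) i j) atTop (𝓝 (P i j)) := fun i j =>
    tendsto_pi_nhds.1 (tendsto_pi_nhds.1 hlim i) j
  refine ⟨P, fun i j => ge_of_tendsto' (hlim' i j) fun k => hB _ i j, fun i j hij => ?_,
    fun i => ?_, fun j => ?_⟩
  · refine lt_of_le_of_ne (hA i j) fun h0 => hij ?_
    refine tendsto_nhds_unique (hlim' i j) ?_
    simp [B, ← h0]
  · exact tendsto_nhds_unique (tendsto_finsetSum _ fun j _ => hlim' i j)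
      ((hr' i).comp hφ.tendsto_atTop)
  · exact tendsto_nhds_unique (tendsto_finsetSum _ fun i _ => hlim' i j)
      ((hc' j).comp hφ.tendsto_atTop)

theorem abs_log_le_bitComplexity {n : ℕ} {A : Matrix (Fin n) (Fin n) ℝ} {i j : Fin n}
    (h : A i j ≠ 0) : |Real.log (A i j)| ≤ bitComplexity A := by
  refine le_csSup ?_ ⟨i, j, h, rfl⟩
  refine (Set.Finite.subset (Set.finite_range fun p : Fin n × Fin n =>
    |Real.log (A p.1 p.2)|) ?_).bddAbove
  rintro t ⟨i, j, -, rfl⟩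
  exact ⟨(i, j), rfl⟩

theorem bitComplexity_nonneg {n : ℕ} (A : Matrix (Fin n) (Fin n) ℝ) : 0 ≤ bitComplexity A :=
  Real.sSup_nonneg (by rintro t ⟨i, j, -, rfl⟩; exact abs_nonneg _)

/-- The square keeps the exponent polynomial and covers `ε > 1`, where the logarithm is negative: `t
≤ 1 + t ^ 2` always. -/
theorem natCast_mul_exp_neg_lt {ε : ℝ} (hε : 0 < ε) (n : ℕ) :
    n * Real.exp (-(n + 1 + Real.log (1 / ε) ^ 2)) < ε := by
  set t := Real.log (1 / ε)
  have ht : ε = Real.exp (-t) := by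
    simp only [t, one_div, Real.log_inv, neg_neg, Real.exp_log hε]
  have h1 : (n : ℝ) < Real.exp n := by linarith [Real.add_one_le_exp (n : ℝ)]
  calc n * Real.exp (-(n + 1 + t ^ 2)) < Real.exp n * Real.exp (-(n + 1 + t ^ 2)) := by gcongr
    _ = Real.exp (-(1 + t ^ 2)) := by rw [← Real.exp_add]; ring_nf
    _ ≤ ε := by rw [ht]; exact Real.exp_le_exp.2 (by nlinarith [sq_nonneg (t - 1)])

theorem abs_sum_sub_lt_of_abs_sub_le {n : ℕ} {f g : Fin n → ℝ} {s δ ε : ℝ}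
    (hfg : ∀ k, |f k - g k| ≤ δ) (hg : ∑ k, g k = s) (hδ : n * δ < ε) : |∑ k, f k - s| < ε := by
  rw [← hg, ← Finset.sum_sub_distrib]
  calc |∑ k, (f k - g k)| ≤ ∑ k, |f k - g k| := Finset.abs_sum_le_sum_abs _ _
    _ ≤ ∑ _k : Fin n, δ := Finset.sum_le_sum fun k _ => hfg k
    _ = n * δ := by simp
    _ < ε := hδ

theorem mainTheorem8 :
    ∃ P : MvPolynomial (Fin 4) ℝ,
      ∀ (n : ℕ) (A : Matrix (Fin n) (Fin n) ℝ) (r c : Fin n → ℕ) (h : ℕ),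
        (∀ i j, 0 ≤ A i j) →
        ∑ i, r i = h → ∑ j, c j = h →
        AsymptoticallyScalable A (fun i => (r i : ℝ)) (fun j => (c j : ℝ)) →
        ∀ ε : ℝ, 0 < ε →
          ∃ x y : Fin n → ℝ,
            (∀ i, 0 < x i) ∧ (∀ j, 0 < y j) ∧
            (∀ i, |∑ k, x i * y k * A i k - (r i : ℝ)| < ε) ∧
            (∀ j, |∑ l, x l * y j * A l j - (c j : ℝ)| < ε) ∧
            (∀ i, |Real.log (x i)| ≤
              MvPolynomial.eval ![(n : ℝ), bitComplexity A, (h : ℝ), Real.log (1 / ε)] P) ∧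
            (∀ j, |Real.log (y j)| ≤
              MvPolynomial.eval ![(n : ℝ), bitComplexity A, (h : ℝ), Real.log (1 / ε)] P) := by
  let N : MvPolynomial (Fin 4) ℝ := .X 0
  let L' : MvPolynomial (Fin 4) ℝ := .X 1
  let H : MvPolynomial (Fin 4) ℝ := .X 2
  let T : MvPolynomial (Fin 4) ℝ := .X 3
  let U' : MvPolynomial (Fin 4) ℝ :=
    (N + N) * (H + L' + N * N * (N * N + 2 * H * L' + H ^ 2))
  refine ⟨U' + (N + N) * (L' + 2 * U' + (N + 1 + T ^ 2)), ?_⟩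
  intro n A r c h hA hr hc hscal ε hε
  classical
  set L := bitComplexity A
  set t := Real.log (1 / ε)
  set W : ℝ := h + L + n * n * (n * n + 2 * h * L + h ^ 2) with hW
  set U : ℝ := (n + n) * W with hU
  -- `L + 2 * U` absorbs `log (A i k) + u i + v k` off the support; the rest brings each such entry
  -- down to `exp (-(n + 1 + t ^ 2))`, small enough for `n` of them to sum to less than `ε`.
  set M : ℝ := L + 2 * U + (n + 1 + t ^ 2) with hM
  have heval : MvPolynomial.eval ![(n : ℝ), L, (h : ℝ), t]
      (U' + (N + N) * (L' + 2 * U' + (N + 1 + T ^ 2))) = U + (n + n) * M := by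
    simp [U', N, L', H, T, U, W, M]
  rw [heval]
  have hL0 : 0 ≤ L := bitComplexity_nonneg A
  have hW0 : 0 ≤ W := by positivity
  have hU0 : 0 ≤ U := by positivity
  have hM0 : 0 ≤ M := by positivity
  obtain ⟨P₀, hP₀, hP₀A, hP₀r, hP₀c⟩ := exists_flow_of_asymptoticallyScalable hA hscal
  obtain ⟨P, hP, hPA, hPr, hPc, hPn, hPmax⟩ :=
    exists_max_support_of_integral_marginals (fun i j => 0 < A i j) hP₀ hP₀A hP₀r hP₀c
  simp only [Fintype.card_fin] at hPn
  obtain ⟨φ, hφn, hφP, hφA⟩ := exists_potential_of_max_support hP hPA (by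
    simp only [hPr, hPc]; exact hPmax)
  simp only [Fintype.card_fin] at hφn
  let S : Finset (Fin n × Fin n) := {p | 0 < P p.1 p.2}
  have hS : ∀ p, p ∈ S ↔ 0 < P p.1 p.2 := fun p => by simp [S]
  have hSA : ∀ p ∈ S, 0 < A p.1 p.2 := fun p hp => hPA _ _ ((hS p).1 hp).ne'
  have hsumS : ∀ f : Fin n × Fin n → ℝ, ∑ p ∈ S, P p.1 p.2 * f p = ∑ i, ∑ j, P i j * f (i, j) := by
    intro f
    rw [← Fintype.sum_prod_type' (f := fun i j => P i j * f (i, j))]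
    refine Finset.sum_subset (Finset.subset_univ S) fun p _ hp => ?_
    rw [le_antisymm (not_lt.1 fun h => hp ((hS p).2 h)) (hP _ _), zero_mul]
  have hPtot : ∑ p ∈ S, P p.1 p.2 = h := by
    have := hsumS fun _ => 1
    simp only [mul_one, hPr] at this
    rw [this, ← hr]; push_cast; rfl
  obtain ⟨u₀, v₀, hmin, hmarg⟩ := exists_exact_scaling S (A := fun p => A p.1 p.2)
    (P := fun p => P p.1 p.2) hSA (fun p hp => (hS p).1 hp)
  have hw : ∀ p ∈ S, |u₀ p.1 + v₀ p.2| ≤ W := fun p hp =>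
    abs_le_of_exact_scaling (A := fun p => A p.1 p.2) (P := fun p => P p.1 p.2) hSA
      (fun p hp => abs_log_le_bitComplexity (hSA p hp).ne')
      (fun p hp => (hS p).1 hp) (fun p hp => hPn _ _ ((hS p).1 hp))
      (by
        have := Finset.card_le_univ S
        simp only [Fintype.card_prod, Fintype.card_fin] at this
        exact_mod_cast this) hPtot hmin hmarg hp
  obtain ⟨u, v, huv, hu, hv⟩ := exists_bounded_scaling S u₀ v₀ hW0 hw
  simp only [Fintype.card_fin] at hu hv
  let B : Fin n → Fin n → ℝ := fun i k =>
    if (i, k) ∈ S then A i k * Real.exp (u₀ i + v₀ k) else 0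
  have hsumB : ∀ f : Fin n × Fin n → ℝ, ∑ p ∈ S, A p.1 p.2 * Real.exp (u₀ p.1 + v₀ p.2) * f p =
      ∑ i, ∑ j, B i j * f (i, j) := by
    intro f
    rw [← Fintype.sum_prod_type' (f := fun i j => B i j * f (i, j))]
    simp only [B, ite_mul, zero_mul, Prod.mk.eta, Finset.sum_ite_mem, Finset.univ_inter]
  have hBr : ∀ i, ∑ k, B i k = r i := by
    intro i
    -- Testing criticality against the indicator of a row yields its row sum.
    have := hmarg (Pi.single i 1) 0
    rw [hsumS fun p => Pi.single (M := fun _ => ℝ) i 1 p.1 + (0 : Fin n → ℝ) p.2,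
      hsumB fun p => Pi.single (M := fun _ => ℝ) i 1 p.1 + (0 : Fin n → ℝ) p.2] at this
    simpa [← Finset.sum_mul, hPr, Pi.single_apply] using this
  have hBc : ∀ j, ∑ l, B l j = c j := by
    intro j
    have := hmarg 0 (Pi.single j 1)
    rw [hsumS fun p => (0 : Fin n → ℝ) p.1 + Pi.single (M := fun _ => ℝ) j 1 p.2,
      hsumB fun p => (0 : Fin n → ℝ) p.1 + Pi.single (M := fun _ => ℝ) j 1 p.2] at this
    simpa [hPc, Pi.single_apply] using this
  have hterm : ∀ i k, |Real.exp (u i - M * φ (.inl i)) * Real.exp (v k + M * φ (.inr k)) * A i k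
      - B i k| ≤ Real.exp (-(n + 1 + t ^ 2)) := by
    intro i k
    rw [← Real.exp_add]
    by_cases hp : (i, k) ∈ S
    · have h1 := hφP i k ((hS _).1 hp)
      have h2 := huv _ hp
      simp only at h2
      have h3 : u i - M * φ (.inl i) + (v k + M * φ (.inr k)) = u₀ i + v₀ k := by
        rw [h1, ← h2]; ring
      simp only [B, if_pos hp, h3]
      rw [mul_comm, sub_self, abs_zero]
      exact (Real.exp_pos _).le
    · simp only [B, if_neg hp, sub_zero]
      rcases (hA i k).eq_or_lt' with h0 | hpos
      · rw [h0, mul_zero, abs_zero]; exact (Real.exp_pos _).le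
      · have h1 : (φ (.inr k) : ℝ) + 1 ≤ φ (.inl i) := by
          exact_mod_cast hφA i k hpos fun h => hp ((hS _).2 h)
        have h2 := mul_le_mul_of_nonneg_left h1 hM0
        have h3 := (abs_le.1 (hu i)).2
        have h4 := (abs_le.1 (hv k)).2
        have h5 := (abs_le.1 (abs_log_le_bitComplexity hpos.ne')).2
        rw [abs_of_pos (mul_pos (Real.exp_pos _) hpos)]
        refine (congrArg _ (Real.exp_log hpos).symm).trans_le ?_
        rw [← Real.exp_add]
        refine Real.exp_le_exp.2 ?_
        linarith
  have hφM : ∀ a, |M * φ a| ≤ (n + n) * M := by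
    intro a
    have h1 : (φ a : ℝ) ≤ n + n := by exact_mod_cast hφn a
    rw [abs_of_nonneg (by positivity), mul_comm]
    gcongr
  refine ⟨fun i => Real.exp (u i - M * φ (.inl i)), fun j => Real.exp (v j + M * φ (.inr j)),
    fun i => Real.exp_pos _, fun j => Real.exp_pos _, fun i => ?_, fun j => ?_, fun i => ?_,
    fun j => ?_⟩
  · exact abs_sum_sub_lt_of_abs_sub_le (fun k => hterm i k) (hBr i) (natCast_mul_exp_neg_lt hε n)
  · exact abs_sum_sub_lt_of_abs_sub_le (fun l => hterm l j) (hBc j) (natCast_mul_exp_neg_lt hε n)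
  · rw [Real.log_exp]
    exact (abs_sub _ _).trans (add_le_add (hu i) (hφM _))
  · rw [Real.log_exp]
    exact (abs_add_le _ _).trans (add_le_add (hv j) (hφM _))
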